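/- Let $(S,\mathfrak n)$ be a commutative noetherian local ring, let $\omega\in\mathfrak n$ be a non-zerodivisor, and put $R=S/(\omega)$. All modules are finitely generated. Let $\mathsf{Mon}(\omega,\mathcal P)$ be the category whose objects are the monomorphisms $(P\xrightarrow{f}Q)$ of projective $S$-modules such that $\omega\,\mathrm{Coker} f=0$ (so that $\mathrm{Coker} f$ is an $R$-module), and whose morphisms $(P\xrightarrow{f}Q)\to(P'\xrightarrow{f'}Q')$ are the pairs $\psi=(\psi_1,\psi_0)$ of $S$-linear maps $\psi_1:P\to P'$, $\psi_0:Q\to Q'$ with $\psi_0f=f'\psi_1$. Such a $\psi$ is null-homotopic if there are $S$-linear maps $s_1:P\to Q'$ and $s_0:Q\to P'$ with $f'\psi_1-f's_0f=\omega s_1$. The homotopy category $\mathsf{HMon}(\omega,\mathcal P)$ has the same objects as $\mathsf{Mon}(\omega,\mathcal P)$, and its morphisms are those of $\mathsf{Mon}(\omega,\mathcal P)$ modulo the null-homotopic ones. An $R$-module is Gorenstein projective if it is a syzygy of a totally acyclic complex of projective $R$-modules, that is, of an acyclic complex $K$ of projective $R$-modules such that $\mathrm{Hom}_R(K,L)$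 is acyclic for every projective $R$-module $L$. Let $\underline{\mathsf{Gp}}(R)$ be the stable category of Gorenstein projective $R$-modules, whose morphisms are the $R$-linear maps modulo those that factor through a projective module. Let $\mathsf{D_{sg}}(R)$ be the singularity category of $R$, i.e. the Verdier quotient of the bounded derived category $\mathsf{D^b}(R)$ of $R$-modules by the perfect complexes (those isomorphic in $\mathsf{D^b}(R)$ to a bounded complex of projective $R$-modules). Then $\mathrm{Coker} f$ is a Gorenstein projective $R$-module for every object $(P\xrightarrow{f}Q)$ of $\mathsf{Mon}(\omega,\mathcal P)$, and there are fully faithful functors $$T:\mathsf{HMon}(\omega,\mathcal P)\longrightarrow\underline{\mathsf{Gp}}(R),\qquad T':\underline{\mathsf{Gp}}(R)\longrightarrow\mathsf{D_{sg}}(R),$$ where $T$ sends each object $(P\xrightarrow{f}Q)$ to $\mathrm{Coker} f$ and the class of a morphism to the class of the induced map of cokernels, and $T'$ sends each module to its stalk complex in degree $0$ and the class of a linear map to the induced morphism of stalk complexes. Consequently the composite $$F=T'\circ T:\mathsf{HMon}(\omega,\mathcal P)\longrightarrow\mathsf{D_{sg}}(R)$$ is a fully faithful functor, which sends each object $(P\xrightarrow{f}Q)$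 to $\mathrm{Coker} f$ viewed as a stalk complex, and the class of a morphism to the morphism of stalk complexes induced by the map of cokernels. -/

import Mathlib

open CategoryTheory CategoryTheory.Limits

universe w u

noncomputable section

/-! ### The category `Mon(ω, P)` and its homotopy category -/

section Mon

variable {S : Type u} [CommRing S] (ω : S)

/-- The objects of `Mon(ω, P)`, among all maps `f : P ⟶ Q` of finitely generated `S`-modules:
`P` and `Q` are projective, `f` is injective, and `Coker f` is annihilated by `ω`. -/
def isMonProj : ObjectProperty (Arrow (FGModuleCat.{u} S)) := fun f =>
  Module.Projective S f.left ∧ Module.Projective S f.right ∧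
    Function.Injective f.hom.hom.hom ∧
    Module.IsTorsionBy S (f.right ⧸ LinearMap.range f.hom.hom.hom) ω

/-- The category `Mon(ω, P)`, a full subcategory of the category of morphisms of finitely
generated `S`-modules (whose morphisms are the commutative squares). -/
abbrev MonProj : Type (u + 1) := (isMonProj ω).FullSubcategory

/-- Two morphisms `φ = (φ₁, φ₀)` and `ψ = (ψ₁, ψ₀)` from `(f : P ⟶ Q)` to `(f' : P' ⟶ Q')` are
homotopic if their difference is null-homotopic: there are `s₁ : P ⟶ Q'` and `s₀ : Q ⟶ P'` with
`f' (φ₁ - ψ₁) - f' s₀ f = ω s₁`. -/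
def monHomotopic : HomRel (MonProj ω) := fun X Y φ ψ =>
  ∃ (s₁ : X.obj.left ⟶ Y.obj.right) (s₀ : X.obj.right ⟶ Y.obj.left),
    (φ.hom.left - ψ.hom.left) ≫ Y.obj.hom - X.obj.hom ≫ s₀ ≫ Y.obj.hom = ω • s₁

/-- Homotopy is an equivalence relation compatible with composition, so that the hom-sets of the
quotient category below are the hom-sets of `Mon(ω, P)` modulo homotopy. -/
instance monHomotopic_congruence : Congruence (monHomotopic ω) where
  equivalence :=
    { refl := fun φ => ⟨0, 0, by simp⟩
      symm := by
        rintro φ ψ ⟨s₁, s₀, h⟩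
        refine ⟨-s₁, -s₀, ?_⟩
        rw [smul_neg, ← h]
        simp only [Preadditive.sub_comp, Preadditive.neg_comp, Preadditive.comp_neg]
        abel
      trans := by
        rintro φ ψ χ ⟨s₁, s₀, h⟩ ⟨t₁, t₀, h'⟩
        refine ⟨s₁ + t₁, s₀ + t₀, ?_⟩
        rw [smul_add, ← h, ← h']
        simp only [Preadditive.sub_comp, Preadditive.add_comp, Preadditive.comp_add]
        abel }
  comp_left := by
    rintro X Y Z f φ ψ ⟨s₁, s₀, h⟩
    refine ⟨f.hom.left ≫ s₁, f.hom.right ≫ s₀, ?_⟩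
    rw [← Linear.comp_smul, ← h]
    simp [Preadditive.sub_comp, Preadditive.comp_sub]
  comp_right := by
    rintro X Y Z φ ψ g ⟨s₁, s₀, h⟩
    refine ⟨s₁ ≫ g.hom.right, s₀ ≫ g.hom.left, ?_⟩
    rw [← Linear.smul_comp, ← h]
    simp [Preadditive.sub_comp]

/-- The homotopy category `HMon(ω, P)`. -/
abbrev HMonProj : Type (u + 1) := Quotient (monHomotopic ω)

/-- The quotient functor `Mon(ω, P) ⥤ HMon(ω, P)`. -/
abbrev HMonProj.quotient : MonProj ω ⥤ HMonProj ω := Quotient.functor (monHomotopic ω)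

variable {ω}

/-- The cokernel of an object `(f : P ⟶ Q)` of `Mon(ω, P)`. -/
def MonProj.Coker (X : MonProj ω) : Type u :=
  X.obj.right ⧸ LinearMap.range X.obj.hom.hom.hom

instance (X : MonProj ω) : AddCommGroup X.Coker :=
  inferInstanceAs (AddCommGroup (X.obj.right ⧸ LinearMap.range X.obj.hom.hom.hom))

instance (X : MonProj ω) : Module S X.Coker :=
  inferInstanceAs (Module S (X.obj.right ⧸ LinearMap.range X.obj.hom.hom.hom))

instance (X : MonProj ω) : Module.Finite S X.Coker :=
  inferInstanceAs (Module.Finite S (X.obj.right ⧸ LinearMap.range X.obj.hom.hom.hom))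

/-- `Coker f` is a module over `R = S/(ω)`. -/
instance (X : MonProj ω) : Module (S ⧸ Ideal.span {ω}) X.Coker :=
  Module.IsTorsionBy.module (R := S) (M := X.Coker) X.property.2.2.2

instance (X : MonProj ω) : IsScalarTower S (S ⧸ Ideal.span {ω}) X.Coker where
  smul_assoc s r x := by
    obtain ⟨r, rfl⟩ := Ideal.Quotient.mk_surjective r
    exact mul_smul s r x

instance (X : MonProj ω) : Module.Finite (S ⧸ Ideal.span {ω}) X.Coker :=
  Module.Finite.of_restrictScalars_finite S _ _

/-- The `R`-linear map `Coker f ⟶ Coker f'` induced by a morphism `(ψ₁, ψ₀)`, i.e. by `ψ₀`. -/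
def MonProj.cokerMap {X Y : MonProj ω} (ψ : X ⟶ Y) :
    X.Coker →ₗ[S ⧸ Ideal.span {ω}] Y.Coker :=
  let g : X.Coker →ₗ[S] Y.Coker :=
    Submodule.mapQ (LinearMap.range X.obj.hom.hom.hom) (LinearMap.range Y.obj.hom.hom.hom)
      ψ.hom.right.hom.hom (by
        rintro _ ⟨p, rfl⟩
        exact ⟨ψ.hom.left.hom.hom p,
          congrArg (fun k : X.obj.left ⟶ Y.obj.right => k.hom.hom p) ψ.hom.w⟩)
  { toFun := g
    map_add' := g.map_add
    map_smul' := fun r x => by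
      obtain ⟨s, rfl⟩ := Ideal.Quotient.mk_surjective r
      exact g.map_smul s x }

variable (ω)

/-- The functor `Mon(ω, P) ⥤ mod R`, `(f : P ⟶ Q) ↦ Coker f`, where `R = S/(ω)`. -/
def MonProj.coker : MonProj ω ⥤ FGModuleCat.{u} (S ⧸ Ideal.span {ω}) where
  obj X := FGModuleCat.of _ X.Coker
  map ψ := FGModuleCat.ofHom (MonProj.cokerMap ψ)
  map_id X := by
    ext x
    obtain ⟨q, rfl⟩ := Submodule.Quotient.mk_surjective _ x
    rfl
  map_comp φ ψ := by
    ext x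
    obtain ⟨q, rfl⟩ := Submodule.Quotient.mk_surjective _ x
    rfl

end Mon

/-! ### Gorenstein projective modules and their stable category -/

section Gorenstein

variable (R : Type u) [CommRing R] [IsNoetherianRing R]

variable {R} in
/-- A totally acyclic complex of finitely generated projective `R`-modules: it is acyclic, and
`Hom(K, P)` is acyclic for every finitely generated projective `R`-module `P`. -/
def IsTotallyAcyclic (K : CochainComplex (FGModuleCat.{u} R) ℤ) : Prop :=
  (∀ i, Module.Projective R (K.X i)) ∧ K.Acyclic ∧
    ∀ P : FGModuleCat.{u} R, Module.Projective R P →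
      ∀ (i : ℤ) (g : K.X i ⟶ P), K.d (i - 1) i ≫ g = 0 →
        ∃ h : K.X (i + 1) ⟶ P, K.d i (i + 1) ≫ h = g

/-- A finitely generated module is Gorenstein projective if it is a syzygy of a totally acyclic
complex of projectives. -/
def isGorensteinProjective : ObjectProperty (FGModuleCat.{u} R) := fun M =>
  ∃ K : CochainComplex (FGModuleCat.{u} R) ℤ, IsTotallyAcyclic K ∧
    ∃ i : ℤ, Nonempty (M ≅ kernel (K.d i (i + 1)))

/-- The category `Gp(R)` of finitely generated Gorenstein projective `R`-modules. -/
abbrev Gp : Type (u + 1) := (isGorensteinProjective R).FullSubcategory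

/-- Two morphisms in `Gp(R)` are stably equal if their difference factors through a (finitely
generated) projective `R`-module. -/
def stablyEqual : HomRel (Gp R) := fun M N f g =>
  ∃ P : FGModuleCat.{u} R, Module.Projective R P ∧
    ∃ (a : M.obj ⟶ P) (b : P ⟶ N.obj), f.hom - g.hom = a ≫ b

/-- Stable equality is an equivalence relation compatible with composition. -/
instance stablyEqual_congruence : Congruence (stablyEqual R) where
  equivalence :=
    { refl := fun f => ⟨FGModuleCat.of R PUnit, inferInstance, 0, 0, by simp⟩
      symm := by
        rintro f g ⟨P, hP, a, b, h⟩
        exact ⟨P, hP, -a, b, by rw [Preadditive.neg_comp, ← h, neg_sub]⟩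
      trans := by
        rintro f g k ⟨P, hP, a, b, h⟩ ⟨P', hP', a', b', h'⟩
        refine ⟨FGModuleCat.of R (P × P'), (inferInstance : Module.Projective R (P × P')),
          FGModuleCat.ofHom (a.hom.hom.prod a'.hom.hom),
          FGModuleCat.ofHom (b.hom.hom.coprod b'.hom.hom), ?_⟩
        rw [← sub_add_sub_cancel f.hom g.hom k.hom, h, h']
        rfl }
  comp_left := by
    rintro L M N f g g' ⟨P, hP, a, b, h⟩
    exact ⟨P, hP, f.hom ≫ a, b, by simp [← Preadditive.comp_sub, h]⟩
  comp_right := by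
    rintro L M N f f' g ⟨P, hP, a, b, h⟩
    exact ⟨P, hP, a, b ≫ g.hom, by simp [← Preadditive.sub_comp, h]⟩

/-- The stable category of `Gp(R)`: the same objects, with morphisms modulo those that factor
through a projective module. -/
abbrev StableGp : Type (u + 1) := Quotient (stablyEqual R)

/-- The quotient functor from `Gp(R)` to the stable category. -/
abbrev StableGp.quotient : Gp R ⥤ StableGp R := Quotient.functor (stablyEqual R)

end Gorenstein

/-! ### The singularity category -/

section Singularity

variable (R : Type u) [CommRing R] [IsNoetherianRing R] [HasDerivedCategory.{w} (FGModuleCat.{u} R)]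

/-- The perfect complexes in the bounded derived category `D^b(R)` of finitely generated
`R`-modules: those isomorphic to a bounded complex of finitely generated projective modules. -/
def isPerfect : ObjectProperty (DerivedCategory.Bounded (FGModuleCat.{u} R)) := fun X =>
  ∃ K : CochainComplex (FGModuleCat.{u} R) ℤ,
    (∃ a : ℤ, K.IsStrictlyGE a) ∧ (∃ b : ℤ, K.IsStrictlyLE b) ∧
    (∀ i, Module.Projective R (K.X i)) ∧ Nonempty (X.obj ≅ DerivedCategory.Q.obj K)

/-- The singularity category of `R`: the Verdier quotient of `D^b(R)` by the perfect complexes,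
i.e. the localization of `D^b(R)` at the morphisms whose cone is perfect. -/
abbrev SingularityCategory := (isPerfect R).trW.Localization

/-- The functor `mod R ⥤ D^b(R)` that sends a module to its stalk complex in degree zero. -/
def stalkComplex : FGModuleCat.{u} R ⥤ DerivedCategory.Bounded (FGModuleCat.{u} R) :=
  ObjectProperty.lift _ (DerivedCategory.singleFunctor (FGModuleCat.{u} R) 0)
    (fun _ => ⟨⟨0, inferInstance⟩, ⟨0, inferInstance⟩⟩)

/-- The functor `mod R ⥤ D_sg(R)` that sends a module to its stalk complex in degree zero. -/
def SingularityCategory.stalk : FGModuleCat.{u} R ⥤ SingularityCategory R :=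
  stalkComplex R ⋙ (isPerfect R).trW.Q

end Singularity

end

-- The functor `T` rests on matrix factorizations. Since ω kills Coker f and f is injective, there
-- is σ : Q → P with fσ = ω and σf = ω (`exists_matrixFactorization`). Over a local ring P and Q are
-- free of the same rank; after identifying them, the reductions of f and σ modulo ω alternate in a
-- totally acyclic complex, in which Coker f is embedded by σ as the kernel of the reduction of f.
-- Maps of cokernels lift to squares because Q is projective, so `T` is full. A null-homotopy
-- amounts to ψ₀ = f's₀ + s₁σ, so the map of cokernels factors through R ⊗ P
-- (`exists_factor_of_monHomotopic`); conversely, a factorization through R^n lifts to S^n and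
-- produces the homotopy (`monHomotopic_of_factor`).
--
-- The functor `T'` rests on the vanishing of Ext^i(M, L) for M Gorenstein projective, L projective
-- and i > 0 (`ext_syzygy_eq_zero`). A morphism M → N in the singularity category is a fraction M →
-- Z ← N, where N → Z has a perfect fibre. Projectives in positive degrees do not map to N, so Z may
-- be enlarged until the fibre X lies in degrees ≤ 0 (`exists_prolongation`). Then X[1] lies in
-- negative degrees and receives no nonzero map from M, so M → Z comes from a map M → N. If a map M
-- → N dies in Z, it factors through X, hence through the degree 0 term of X, which is projective.

universe v

/-! ### Bounded complexes of projectives in the derived category -/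

namespace DerivedCategory

open Pretriangulated ZeroObject

variable {C : Type u} [Category.{v} C] [Abelian C] [HasDerivedCategory.{w} C]

/-- In the derived category, a morphism from a K-projective complex is represented by a
morphism of complexes. -/
lemma exists_Q_map_eq_of_isKProjective {K L : CochainComplex C ℤ} [K.IsKProjective]
    (f : Q.obj K ⟶ Q.obj L) : ∃ g : K ⟶ L, Q.map g = f := by
  obtain ⟨g, hg⟩ := (CochainComplex.IsKProjective.Qh_map_bijective K _).surjective
    ((quotientCompQhIso C).hom.app K ≫ f ≫ (quotientCompQhIso C).inv.app L)
  obtain ⟨g, rfl⟩ := (HomotopyCategory.quotient _ _).map_surjective g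
  refine ⟨g, ?_⟩
  rw [← cancel_epi ((quotientCompQhIso C).hom.app K), ← quotientCompQhIso_hom_naturality, hg]
  simp

variable (C) in
/-- The objects of the derived category represented by a complex of projective objects which is
concentrated in degrees `a, …, b`. -/
def projectiveAmplitude (a b : ℤ) : ObjectProperty (DerivedCategory C) := fun X =>
  ∃ K : CochainComplex C ℤ, K.IsStrictlyGE a ∧ K.IsStrictlyLE b ∧
    (∀ i, Projective (K.X i)) ∧ Nonempty (X ≅ Q.obj K)

variable (C) in
/-- The objects of the derived category represented by a bounded complex of projective objects. -/
def perfect : ObjectProperty (DerivedCategory C) := fun X => ∃ a b, projectiveAmplitude C a b X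

lemma projectiveAmplitude_mono {a b a' b' : ℤ} (ha : a' ≤ a) (hb : b ≤ b') :
    projectiveAmplitude C a b ≤ projectiveAmplitude C a' b' := by
  rintro X ⟨K, _, _, hK, e⟩
  exact ⟨K, K.isStrictlyGE_of_ge a' a ha, K.isStrictlyLE_of_le b b' hb, hK, e⟩

instance (a b : ℤ) : (projectiveAmplitude C a b).IsClosedUnderIsomorphisms where
  of_iso := by
    rintro X Y e ⟨K, h₁, h₂, hK, ⟨e'⟩⟩
    exact ⟨K, h₁, h₂, hK, ⟨e.symm ≪≫ e'⟩⟩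

instance : (perfect C).IsClosedUnderIsomorphisms where
  of_iso := by
    rintro X Y e ⟨a, b, hX⟩
    exact ⟨a, b, (projectiveAmplitude C a b).prop_of_iso e hX⟩

lemma projectiveAmplitude_shift {a b : ℤ} {X : DerivedCategory C}
    (hX : projectiveAmplitude C a b X) (n a' b' : ℤ) (ha : n + a' = a) (hb : n + b' = b) :
    projectiveAmplitude C a' b' (X⟦n⟧) := by
  obtain ⟨K, _, _, hK, ⟨e⟩⟩ := hX
  exact ⟨K⟦n⟧, K.isStrictlyGE_shift a n a' ha, K.isStrictlyLE_shift b n b' hb,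
    fun i => Projective.of_iso (K.shiftFunctorObjXIso n i _ rfl).symm (hK _),
    ⟨(shiftFunctor _ n).mapIso e ≪≫ (Q.commShiftIso n).symm.app K⟩⟩

lemma projectiveAmplitude_of_isZero (a b : ℤ) {X : DerivedCategory C} (hX : IsZero X) :
    projectiveAmplitude C a b X := by
  have h (i : ℤ) : IsZero ((0 : CochainComplex C ℤ).X i) :=
    (HomologicalComplex.eval C _ i).map_isZero (isZero_zero _)
  refine ⟨0, (CochainComplex.isStrictlyGE_iff _ _).2 fun i _ => h i,
    (CochainComplex.isStrictlyLE_iff _ _).2 fun i _ => h i, fun i => ?_,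
    ⟨hX.iso (Q.map_isZero (isZero_zero _))⟩⟩
  exact Projective.of_iso (h i).isoZero.symm inferInstance

instance : (perfect C).ContainsZero where
  exists_zero := ⟨0, isZero_zero _, 0, 0, projectiveAmplitude_of_isZero 0 0 (isZero_zero _)⟩

instance : (perfect C).IsStableUnderShift ℤ where
  isStableUnderShiftBy n :=
    { le_shift := by
        rintro X ⟨a, b, hX⟩
        exact ⟨a - n, b - n, projectiveAmplitude_shift hX n _ _ (by lia) (by lia)⟩ }

/-- The mapping cone of a map in the derived category between bounded complexes of projectives
is a bounded complex of projectives. -/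
lemma projectiveAmplitude_of_distTriang {T : Triangle (DerivedCategory C)}
    (hT : T ∈ distTriang _) {a b a' b' : ℤ} (h₁ : projectiveAmplitude C a b T.obj₁)
    (h₂ : projectiveAmplitude C a' b' T.obj₂) :
    projectiveAmplitude C (min (a - 1) a') (max (b - 1) b') T.obj₃ := by
  -- K is K-projective, so the map lifts to a chain map, whose cone has terms K^(i+1) ⊞ L^i; this
  -- explains the bounds `a - 1` and `b - 1`.
  obtain ⟨K, _, _, hK, ⟨e₁⟩⟩ := h₁
  obtain ⟨L, _, _, hL, ⟨e₂⟩⟩ := h₂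
  have := K.isKProjective_of_projective b
  obtain ⟨φ, hφ⟩ := exists_Q_map_eq_of_isKProjective (e₁.inv ≫ T.mor₁ ≫ e₂.hom)
  obtain ⟨e, -⟩ := exists_iso_of_arrow_iso _ _ hT (mappingCone_triangle_distinguished φ)
    (Arrow.isoMk e₁ e₂ (by
      change e₁.hom ≫ Q.map φ = T.mor₁ ≫ e₂.hom
      rw [hφ, e₁.hom_inv_id_assoc]))
  let e' (i : ℤ) : (CochainComplex.mappingCone φ).X i ≅ K.X (i + 1) ⊞ L.X i :=
    HomologicalComplex.homotopyCofiber.XIsoBiprod φ i (i + 1) rfl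
  refine ⟨CochainComplex.mappingCone φ, ?_, ?_, fun i => ?_, ⟨Triangle.π₃.mapIso e⟩⟩
  · rw [CochainComplex.isStrictlyGE_iff]
    intro i hi
    refine IsZero.of_iso ?_ (e' i)
    rw [biprod_isZero_iff]
    exact ⟨K.isZero_of_isStrictlyGE a _, L.isZero_of_isStrictlyGE a' _⟩
  · rw [CochainComplex.isStrictlyLE_iff]
    intro i hi
    refine IsZero.of_iso ?_ (e' i)
    rw [biprod_isZero_iff]
    exact ⟨K.isZero_of_isStrictlyLE b _, L.isZero_of_isStrictlyLE b' _⟩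
  · exact Projective.of_iso (e' i).symm inferInstance

/-- Closure under cones suffices, because stability under shift allows triangles to be rotated. -/
instance : (perfect C).IsTriangulated where
  toIsTriangulatedClosed₂ := by
    have : (perfect C).IsTriangulatedClosed₃ := .mk' (by
      rintro T hT ⟨a, b, h⟩ ⟨a', b', h'⟩
      exact ⟨_, _, projectiveAmplitude_of_distTriang hT h h'⟩)
    exact .of_isTriangulatedClosed₃

/-- A bounded complex of projectives in degrees `≤ b` is an extension of a bounded complex of
projectives in degrees `≤ b - 1` by its term in degree `b`. -/
lemma exists_distTriang_of_projectiveAmplitude {a b : ℤ} {X : DerivedCategory C}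
    (hX : projectiveAmplitude C a b X) :
    ∃ (P : C) (_ : Projective P) (Y : DerivedCategory C) (_ : projectiveAmplitude C a (b - 1) Y)
      (f : (singleFunctor C b).obj P ⟶ X) (g : X ⟶ Y) (h : Y ⟶ _),
      Triangle.mk f g h ∈ distTriang _ := by
  obtain ⟨K, _, _, hK, ⟨e⟩⟩ := hX
  -- As K vanishes above degree b, its top term is a subcomplex; the quotient agrees with K away
  -- from b and vanishes at b.
  let ι : (HomologicalComplex.single C (.up ℤ) b).obj (K.X b) ⟶ K :=
    HomologicalComplex.mkHomFromSingle (𝟙 _) fun k hk =>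
      (K.isZero_of_isStrictlyLE b k (by simp at hk; lia)).eq_of_tgt _ _
  have hι : Mono ι := by
    refine @HomologicalComplex.mono_of_mono_f _ _ _ _ _ _ _ ι fun i => ?_
    by_cases hi : i = b
    · subst hi
      simp only [ι, HomologicalComplex.mkHomFromSingle_f]
      infer_instance
    · exact ⟨fun _ _ _ => (HomologicalComplex.isZero_single_obj_X _ _ _ _ hi).eq_of_tgt _ _⟩
  let S : ShortComplex (CochainComplex C ℤ) := .mk ι (cokernel.π ι) (by simp)
  have hS : S.ShortExact :=
    { exact := S.exact_of_g_is_cokernel (cokernelIsCokernel ι) }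
  have hSi (i : ℤ) := hS.map_of_exact (HomologicalComplex.eval C _ i)
  have iso (i : ℤ) (hi : i ≠ b) : IsIso ((cokernel.π ι).f i) :=
    (hSi i).isIso_g_iff.2 (HomologicalComplex.isZero_single_obj_X (.up ℤ) _ _ _ hi)
  have zero : IsZero ((cokernel ι).X b) := (hSi b).isIso_f_iff.1 (by
    change IsIso (ι.f b)
    simp only [ι, HomologicalComplex.mkHomFromSingle_f]
    infer_instance)
  refine ⟨K.X b, hK b, Q.obj (cokernel ι), ⟨cokernel ι, ?_, ?_, fun i => ?_, ⟨Iso.refl _⟩⟩,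
    Q.map ι ≫ e.inv, e.hom ≫ Q.map (cokernel.π ι), triangleOfSESδ hS,
    isomorphic_distinguished _ (triangleOfSES_distinguished hS) _
      (Triangle.isoMk _ _ (Iso.refl _) e (Iso.refl _) ?_ ?_ ?_)⟩
  rotate_left 3
  · change (Q.map ι ≫ e.inv) ≫ e.hom = 𝟙 _ ≫ Q.map ι
    rw [Category.assoc, e.inv_hom_id, Category.comp_id]
    exact (Category.id_comp _).symm
  · change (e.hom ≫ Q.map (cokernel.π ι)) ≫ 𝟙 _ = e.hom ≫ Q.map (cokernel.π ι)
    simp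
  · change triangleOfSESδ hS ≫ (𝟙 _)⟦(1 : ℤ)⟧' = 𝟙 _ ≫ triangleOfSESδ hS
    rw [CategoryTheory.Functor.map_id, Category.comp_id, Category.id_comp]
  · rw [CochainComplex.isStrictlyGE_iff]
    intro i hi
    by_cases hb : i = b
    · exact hb ▸ zero
    · have := iso i hb
      exact (K.isZero_of_isStrictlyGE a i).of_iso (asIso ((cokernel.π ι).f i)).symm
  · rw [CochainComplex.isStrictlyLE_iff]
    intro i hi
    by_cases hb : i = b
    · exact hb ▸ zero
    · have := iso i hb
      exact (K.isZero_of_isStrictlyLE b i).of_iso (asIso ((cokernel.π ι).f i)).symm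
  · by_cases hb : i = b
    · subst hb
      exact Projective.of_iso zero.isoZero.symm inferInstance
    · have := iso i hb
      exact Projective.of_iso (asIso ((cokernel.π ι).f i)) (hK i)

/-- A morphism from a bounded complex of projectives to an object concentrated in degree `0`
factors through a bounded complex of projectives in nonpositive degrees. -/
lemma exists_factor_of_projectiveAmplitude (N : C) {a : ℤ} (b : ℕ) {X : DerivedCategory C}
    (hX : projectiveAmplitude C a b X) (u : X ⟶ (singleFunctor C 0).obj N) :
    ∃ (Y : DerivedCategory C) (_ : projectiveAmplitude C a 0 Y) (p : X ⟶ Y)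
      (q : Y ⟶ (singleFunctor C 0).obj N), p ≫ q = u := by
  induction b generalizing X with
  | zero => exact ⟨X, hX, 𝟙 X, u, by simp⟩
  | succ b ih =>
    obtain ⟨P, _, Y, hY, f, g, h, hT⟩ := exists_distTriang_of_projectiveAmplitude hX
    -- Here P sits in degree b + 1 > 0, so f ≫ u is a class in Ext^(b+1)(P, N) = 0. Thus u descends
    -- to Y, from which the top term has been removed.
    have hf : f ≫ u = 0 := from_singleFunctor_obj_eq_zero_of_projective
      (L := (CochainComplex.singleFunctor C 0).obj N) _ 0 (by lia)
    obtain ⟨u', rfl⟩ := Triangle.yoneda_exact₂ _ hT u hf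
    obtain ⟨Z, hZ, p, q, rfl⟩ := ih (by simpa using hY) u'
    exact ⟨Z, hZ, g ≫ p, q, Category.assoc _ _ _⟩

variable (M : C)

/-- If there are no nonzero morphisms from `M` to projective objects placed in negative degrees,
there are none to bounded complexes of projectives in negative degrees. -/
lemma eq_zero_of_projectiveAmplitude
    (hM : ∀ (P : C) [Projective P] (n : ℤ), n < 0 →
      ∀ f : (singleFunctor C 0).obj M ⟶ (singleFunctor C n).obj P, f = 0)
    (l : ℕ) {b : ℤ} (hb : b < 0) {X : DerivedCategory C}
    (hX : projectiveAmplitude C (b + 1 - l) b X) (u : (singleFunctor C 0).obj M ⟶ X) :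
    u = 0 := by
  -- The number l counts the degrees from b + 1 - l to b; for l = 0 the complex is zero.
  induction l generalizing b X with
  | zero =>
    obtain ⟨K, _, _, -, ⟨e⟩⟩ := hX
    have hK : IsZero K := by
      rw [IsZero.iff_id_eq_zero]
      ext i
      obtain hi | hi := le_or_gt i b
      · exact (K.isZero_of_isStrictlyGE (b + 1 - (0 : ℕ)) i (by simp; lia)).eq_of_src _ _
      · exact (K.isZero_of_isStrictlyLE b i).eq_of_src _ _
    exact ((Q.map_isZero hK).of_iso e).eq_of_tgt _ _
  | succ l ih =>
    obtain ⟨P, _, Y, hY, f, g, h, hT⟩ := exists_distTriang_of_projectiveAmplitude hX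
    have hu : u ≫ g = 0 := ih (b := b - 1) (by lia)
      (projectiveAmplitude_mono (by push_cast; lia) le_rfl _ hY) _
    obtain ⟨u', rfl⟩ := Triangle.coyoneda_exact₂ _ hT u hu
    rw [hM P b hb u']
    exact zero_comp

lemma eq_zero_of_projectiveAmplitude'
    (hM : ∀ (P : C) [Projective P] (n : ℤ), n < 0 →
      ∀ f : (singleFunctor C 0).obj M ⟶ (singleFunctor C n).obj P, f = 0)
    {a b : ℤ} (hb : b < 0) {X : DerivedCategory C}
    (hX : projectiveAmplitude C a b X) (u : (singleFunctor C 0).obj M ⟶ X) :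
    u = 0 :=
  eq_zero_of_projectiveAmplitude M hM (b + 1 - a).toNat hb
    (projectiveAmplitude_mono (by lia) le_rfl _ hX) u

/-- Under the same assumption, morphisms to a bounded complex of projectives in nonpositive
degrees factor through a projective object. -/
lemma exists_factor_through_projective
    (hM : ∀ (P : C) [Projective P] (n : ℤ), n < 0 →
      ∀ f : (singleFunctor C 0).obj M ⟶ (singleFunctor C n).obj P, f = 0)
    {a : ℤ} {X : DerivedCategory C}
    (hX : projectiveAmplitude C a 0 X) (u : (singleFunctor C 0).obj M ⟶ X) :
    ∃ (P : C) (_ : Projective P) (p : (singleFunctor C 0).obj M ⟶ (singleFunctor C 0).obj P)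
      (q : (singleFunctor C 0).obj P ⟶ X), p ≫ q = u := by
  obtain ⟨P, hP, Y, hY, f, g, h, hT⟩ := exists_distTriang_of_projectiveAmplitude hX
  obtain ⟨u', hu'⟩ := Triangle.coyoneda_exact₂ _ hT u
    (eq_zero_of_projectiveAmplitude' M hM (by lia) hY _)
  exact ⟨P, hP, u', f, hu'.symm⟩

end DerivedCategory

/-! ### Morphisms between stalk complexes in the singularity category -/

namespace DerivedCategory.Bounded

open Pretriangulated DerivedCategory.TStructure

variable {C : Type u} [Category.{v} C] [Abelian C] [HasDerivedCategory.{w} C]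

variable (C) in
/-- The perfect objects of the bounded derived category. -/
abbrev perfect : ObjectProperty (Bounded C) := (DerivedCategory.perfect C).inverseImage ι

variable (C) in
/-- The functor `C ⥤ D^b(C)` which sends an object to its stalk complex in degree `0`. -/
noncomputable abbrev single : C ⥤ Bounded C :=
  ObjectProperty.lift _ (singleFunctor C 0) fun _ => ⟨⟨0, inferInstance⟩, ⟨0, inferInstance⟩⟩

lemma prop_of_projectiveAmplitude {a b : ℤ} {X : DerivedCategory C}
    (hX : projectiveAmplitude C a b X) : (t : Triangulated.TStructure (DerivedCategory C)).bounded X := by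
  obtain ⟨K, _, _, -, ⟨e⟩⟩ := hX
  exact ⟨⟨a, K, e, inferInstance⟩, ⟨b, K, e, inferInstance⟩⟩

/-- An object `M` of an abelian category is left orthogonal to projectives if there are no
nonzero extensions of positive degree of `M` by projective objects. -/
def IsLeftOrthogonalToProjectives (M : C) : Prop :=
  ∀ (P : C) [Projective P] (n : ℤ), n < 0 →
    ∀ f : (singleFunctor C 0).obj M ⟶ (singleFunctor C n).obj P, f = 0

variable {M N : C}

/-- A morphism with perfect cone from a stalk complex `N` can be prolonged in such a way that the
cone is a bounded complex of projectives in negative degrees. -/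
lemma exists_prolongation (hM : IsLeftOrthogonalToProjectives M) {Z : Bounded C}
    (s : (single C).obj N ⟶ Z) (hs : (perfect C).trW s) :
    ∃ (Z' : Bounded C) (t : Z ⟶ Z'), (perfect C).trW (s ≫ t) ∧
      (∀ g : (single C).obj M ⟶ Z', ∃ f : M ⟶ N, (single C).map f ≫ s ≫ t = g) ∧
      (∀ f : M ⟶ N, (single C).map f ≫ s ≫ t = 0 →
        ∃ (P : C) (_ : Projective P) (p : M ⟶ P) (q : P ⟶ N), p ≫ q = f) := by
  rw [ObjectProperty.trW_iff'] at hs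
  obtain ⟨X, u, h, hT, a, b, hX⟩ := hs
  obtain ⟨Y, hY, p, q, hpq⟩ := exists_factor_of_projectiveAmplitude N b.toNat
    (projectiveAmplitude_mono le_rfl (by lia) _ hX) (ι.map u)
  let Y' : Bounded C := ⟨Y, prop_of_projectiveAmplitude hY⟩
  let p' : X ⟶ Y' := ObjectProperty.homMk p
  -- The new denominator is the cone of Y → N. Since u factors through q, the map from N to this
  -- cone kills u, hence extends over Z.
  let q' : Y' ⟶ (single C).obj N := ObjectProperty.homMk q
  have hu : u = p' ≫ q' := by
    ext
    exact hpq.symm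
  obtain ⟨Z', s', h', hT'⟩ := distinguished_cocone_triangle q'
  have hs' : q' ≫ s' = 0 := comp_distTriang_mor_zero₁₂ _ hT'
  obtain ⟨t, rfl⟩ : ∃ t : Z ⟶ Z', s' = s ≫ t := Triangle.yoneda_exact₂ _ hT s' (by
    change u ≫ s' = 0
    rw [hu, Category.assoc, hs', comp_zero])
  refine ⟨Z', t, ?_, fun g => ?_, fun f hf => ?_⟩
  · rw [ObjectProperty.trW_iff']
    exact ⟨Y', q', h', hT', _, _, hY⟩
  -- The target Y[1] lives in degrees ≤ -1, where M has no nonzero maps. The comparison isomorphism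
  -- moves the shift of D^b into the full derived category.
  · have hg : g ≫ h' = 0 := by
      apply ι.map_injective
      rw [← cancel_mono ((ι.commShiftIso (1 : ℤ)).hom.app Y'), Functor.map_zero, zero_comp]
      exact eq_zero_of_projectiveAmplitude' M hM (b := -1) (by lia)
        (projectiveAmplitude_shift hY 1 (a - 1) (-1) (by lia) (by lia)) _
    obtain ⟨f, hf⟩ := Triangle.coyoneda_exact₃ _ hT' g hg
    obtain ⟨f', hf'⟩ := (singleFunctor C 0).map_surjective (ι.map f)
    refine ⟨f', ?_⟩
    rw [show (single C).map f' = f from ι.map_injective hf']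
    exact hf.symm
  · obtain ⟨f', hf'⟩ := Triangle.coyoneda_exact₂ _ hT' _ hf
    obtain ⟨P, hP, v, w, hvw⟩ := exists_factor_through_projective M hM hY (ι.map f')
    obtain ⟨v, rfl⟩ := (singleFunctor C 0).map_surjective v
    obtain ⟨w', hw'⟩ := (singleFunctor C 0).map_surjective (w ≫ q)
    refine ⟨P, hP, v, w', (singleFunctor C 0).map_injective ?_⟩
    rw [Functor.map_comp, hw', reassoc_of% hvw]
    exact (congr_arg ι.map hf').symm

/-- Two parallel morphisms in `C` whose difference factors through a projective object are
identified in the singularity category. -/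
lemma Q_map_single_map_eq {f g : M ⟶ N} {P : C} [Projective P] (a : M ⟶ P) (b : P ⟶ N)
    (h : f - g = a ≫ b) :
    (perfect C).trW.Q.map ((single C).map f) = (perfect C).trW.Q.map ((single C).map g) := by
  rw [MorphismProperty.map_eq_iff_postcomp (perfect C).trW.Q (perfect C).trW]
  -- The map s from N to the cone of b has the perfect fibre P, so it becomes invertible, and it
  -- kills b.
  obtain ⟨Z, s, d, hT⟩ := distinguished_cocone_triangle ((single C).map b)
  have hs : (single C).map b ≫ s = 0 := comp_distTriang_mor_zero₁₂ _ hT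
  refine ⟨Z, s, ?_, ?_⟩
  · rw [ObjectProperty.trW_iff']
    refine ⟨_, _, _, hT, 0, 0, (CochainComplex.singleFunctor C 0).obj P, ?_, ?_, fun i => ?_,
      ⟨Iso.refl _⟩⟩
    · infer_instance
    · infer_instance
    · by_cases hi : i = 0
      · subst hi
        exact Projective.of_iso (HomologicalComplex.singleObjXSelf (.up ℤ) 0 P).symm inferInstance
      · exact Projective.of_iso
          (HomologicalComplex.isZero_single_obj_X (.up ℤ) 0 P i hi).isoZero.symm inferInstance
  · have h' : (single C).map f = (single C).map g + (single C).map a ≫ (single C).map b := by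
      rw [← Functor.map_comp, show f = g + a ≫ b by rw [← h, add_sub_cancel]]
      ext
      exact (singleFunctor C 0).map_add
    rw [h', Preadditive.add_comp, Category.assoc, hs, comp_zero, add_zero]

/-- Morphisms in the singularity category between stalk complexes are represented by morphisms
in `C`. -/
lemma exists_Q_map_single_map_eq (hM : IsLeftOrthogonalToProjectives M)
    (φ : (perfect C).trW.Q.obj ((single C).obj M) ⟶ (perfect C).trW.Q.obj ((single C).obj N)) :
    ∃ f : M ⟶ N, (perfect C).trW.Q.map ((single C).map f) = φ := by
  obtain ⟨ψ, rfl⟩ := Localization.exists_leftFraction (perfect C).trW.Q (perfect C).trW φ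
  obtain ⟨Z, t, hst, h, -⟩ := exists_prolongation hM ψ.s ψ.hs
  obtain ⟨f, hf⟩ := h (ψ.f ≫ t)
  refine ⟨f, ?_⟩
  have : IsIso ((perfect C).trW.Q.map (ψ.s ≫ t)) := Localization.inverts _ _ _ hst
  rw [← cancel_mono ((perfect C).trW.Q.map (ψ.s ≫ t)), ← Functor.map_comp, hf, Functor.map_comp,
    Functor.map_comp, ψ.map_comp_map_s_assoc]

/-- Two parallel morphisms in `C` are identified in the singularity category only if their
difference factors through a projective object. -/
lemma exists_factor_of_Q_map_single_map_eq (hM : IsLeftOrthogonalToProjectives M) {f g : M ⟶ N}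
    (h : (perfect C).trW.Q.map ((single C).map f) = (perfect C).trW.Q.map ((single C).map g)) :
    ∃ (P : C) (_ : Projective P) (a : M ⟶ P) (b : P ⟶ N), f - g = a ≫ b := by
  rw [MorphismProperty.map_eq_iff_postcomp (perfect C).trW.Q (perfect C).trW] at h
  obtain ⟨Z, s, hs, h⟩ := h
  obtain ⟨Z', t, -, -, H⟩ := exists_prolongation hM s hs
  obtain ⟨P, hP, a, b, hab⟩ := H (f - g) (by
    have : (single C).map (f - g) = (single C).map f - (single C).map g := by
      ext
      exact (singleFunctor C 0).map_sub
    rw [this, Preadditive.sub_comp, reassoc_of% h, sub_self])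
  exact ⟨P, hP, a, b, hab.symm⟩

end DerivedCategory.Bounded

/-! ### Vanishing of Ext from syzygies of totally acyclic complexes -/

namespace DerivedCategory.Bounded

variable {C : Type u} [Category.{v} C] [Abelian C]

/-- The condition that every chain map from `K` to a stalk complex of a projective object `P` is
null-homotopic. -/
def HomToProjectivesAcyclic (K : CochainComplex C ℤ) : Prop :=
  ∀ (P : C) [Projective P] (i : ℤ) (g : K.X i ⟶ P), K.d (i - 1) i ≫ g = 0 →
    ∃ h : K.X (i + 1) ⟶ P, K.d i (i + 1) ≫ h = g

lemma epi_kernelLift_d {K : CochainComplex C ℤ} (hK : K.Acyclic) {i j k : ℤ} (hij : i + 1 = j) (hjk : j + 1 = k) :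
    Epi (kernel.lift (K.d j k) (K.d i j) (K.d_comp_d i j k)) := by
  have h := (K.exactAt_iff' i j k (by simp; lia) (by simp [hjk])).1 (hK j)
  exact h.epi_kernelLift

/-- The short exact sequence which relates two consecutive syzygies of an acyclic complex. -/
noncomputable abbrev syzygyShortComplex (K : CochainComplex C ℤ) (i j k : ℤ) : ShortComplex C :=
  .mk (kernel.ι (K.d i j)) (kernel.lift (K.d j k) (K.d i j) (K.d_comp_d i j k)) (by
    rw [← cancel_mono (kernel.ι _)]
    simp)

lemma syzygyShortComplex_shortExact {K : CochainComplex C ℤ} (hK : K.Acyclic) {i j k : ℤ} (hij : i + 1 = j) (hjk : j + 1 = k) :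
    (syzygyShortComplex K i j k).ShortExact where
  exact := by
    apply ShortComplex.exact_of_f_is_kernel
    refine KernelFork.IsLimit.ofι' _ _ fun {A} a ha => ⟨kernel.lift _ a ?_, kernel.lift_ι _ _ _⟩
    simpa using ha =≫ kernel.ι _
  epi_g := epi_kernelLift_d hK hij hjk

/-- Dimension shifting along 0 → Z^i → K^i → Z^(i+1) → 0 reduces to Ext^1. A class in Ext^1 is the
image under the connecting map of some φ : Z^i → P, and it vanishes once φ extends to K^i. -/
lemma ext_syzygy_eq_zero [HasExt.{w} C] {K : CochainComplex C ℤ} (hK : K.Acyclic)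
    (hproj : ∀ i, Projective (K.X i))
    (hP : HomToProjectivesAcyclic K) (P : C) [Projective P] (n : ℕ)
    {j k : ℤ} (hjk : j + 1 = k) (x : Abelian.Ext (kernel (K.d j k)) P (n + 1)) : x = 0 := by
  induction n generalizing j k with
  | zero =>
    obtain ⟨l, rfl⟩ : ∃ l : ℤ, j = l + 1 + 1 := ⟨j - 1 - 1, by lia⟩
    have hS := syzygyShortComplex_shortExact hK (rfl : l + 1 + 1 = _) hjk
    obtain ⟨x₁, rfl⟩ := Abelian.Ext.contravariant_sequence_exact₃ hS P x
      (Abelian.Ext.eq_zero_of_projective _) (add_zero 1)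
    obtain ⟨φ, rfl⟩ := (Abelian.Ext.mk₀_bijective _ _).2 x₁
    -- The composite K^l → Z^(l+1) → P is a cocycle of Hom(K, P), so it is ψ composed with the
    -- differential. As K^l → Z^(l+1) is epi, ψ extends φ.
    obtain ⟨ψ, hψ⟩ := hP P l (kernel.lift (K.d (l + 1) (l + 1 + 1)) (K.d l (l + 1)) (by simp) ≫ φ)
      (by
        rw [← Category.assoc, show K.d (l - 1) l ≫ kernel.lift (K.d (l + 1) (l + 1 + 1))
          (K.d l (l + 1)) (by simp) = 0 from by rw [← cancel_mono (kernel.ι _)]; simp, zero_comp])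
    have := epi_kernelLift_d hK (rfl : l + 1 = _) (rfl : l + 1 + 1 = _)
    have hφ : kernel.ι (K.d (l + 1) (l + 1 + 1)) ≫ ψ = φ := by
      rw [← cancel_epi (kernel.lift (K.d (l + 1) (l + 1 + 1)) (K.d l (l + 1)) (K.d_comp_d _ _ _)), ← hψ]
      simp
    rw [← hφ, ← Abelian.Ext.mk₀_comp_mk₀, hS.extClass_comp_assoc]
  | succ n ih =>
    obtain ⟨i, rfl⟩ : ∃ i : ℤ, j = i + 1 := ⟨j - 1, by lia⟩
    have hS := syzygyShortComplex_shortExact hK (rfl : i + 1 = _) hjk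
    obtain ⟨x₁, rfl⟩ := Abelian.Ext.contravariant_sequence_exact₃ hS P x
      (Abelian.Ext.eq_zero_of_projective _) (by lia : 1 + (n + 1) = _)
    rw [ih rfl x₁, Abelian.Ext.comp_zero]

variable [HasDerivedCategory.{w} C]

lemma isLeftOrthogonalToProjectives_of_ext {M : C} [HasExt.{w} C]
    (hM : ∀ (P : C) [Projective P] (n : ℕ) (x : Abelian.Ext M P (n + 1)), x = 0) :
    IsLeftOrthogonalToProjectives M := by
  intro P _ n hn f
  obtain ⟨m, rfl⟩ : ∃ m : ℕ, n = -((m + 1 : ℕ) : ℤ) := ⟨(-n - 1).toNat, by lia⟩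
  -- The stalk in degree -(m+1) is the (m+1)-fold shift of the stalk in degree 0, so f is a class in
  -- Ext^(m+1)(M, P).
  let e := ((singleFunctors C).shiftIso ((m + 1 : ℕ) : ℤ) (-((m + 1 : ℕ) : ℤ)) 0 (by lia)).app P
  obtain ⟨x, hx⟩ := (Abelian.Ext.homEquiv (X := M) (Y := P) (n := m + 1)).surjective (f ≫ e.inv)
  rw [hM P m x] at hx
  rw [← cancel_mono e.inv, ← hx, zero_comp]
  exact Abelian.Ext.zero_hom _ _ _

lemma isLeftOrthogonalToProjectives_of_iso {M N : C} (e : M ≅ N)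
    (hM : IsLeftOrthogonalToProjectives M) : IsLeftOrthogonalToProjectives N := by
  intro P _ n hn f
  rw [← cancel_epi ((singleFunctor C 0).map e.hom), comp_zero]
  exact hM P n hn _

/-- The syzygies of a totally acyclic complex of projective objects are left orthogonal to
projective objects. -/
lemma isLeftOrthogonalToProjectives_syzygy {K : CochainComplex C ℤ} (hK : K.Acyclic)
    (hproj : ∀ i, Projective (K.X i)) (hP : HomToProjectivesAcyclic K) (i : ℤ) :
    IsLeftOrthogonalToProjectives (kernel (K.d i (i + 1))) := by
  have := hasExt_of_hasDerivedCategory.{w} C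
  exact isLeftOrthogonalToProjectives_of_ext fun P _ n x =>
    ext_syzygy_eq_zero hK hproj hP P n rfl x

end DerivedCategory.Bounded

/-! ### Exactness and projectivity in the category of finitely generated modules -/

namespace FGModuleCat

variable {R : Type u} [CommRing R]

lemma hom_apply_eq_zero {A B D : FGModuleCat.{u} R} {f : A ⟶ B} {g : B ⟶ D} (h : f ≫ g = 0)
    (x : A) : g.hom.hom (f.hom.hom x) = 0 :=
  congrArg (fun k : A ⟶ D => k.hom.hom x) h

variable [IsNoetherianRing R]

lemma surjective_of_epi {M N : FGModuleCat.{u} R} (f : M ⟶ N) [Epi f] :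
    Function.Surjective f.hom.hom :=
  (ModuleCat.epi_iff_surjective _).1
    (inferInstance : Epi ((forget₂ (FGModuleCat R) (ModuleCat R)).map f))

lemma epi_of_surjective {M N : FGModuleCat.{u} R} (f : M ⟶ N)
    (hf : Function.Surjective f.hom.hom) : Epi f :=
  (forget₂ (FGModuleCat R) (ModuleCat R)).epi_of_epi_map ((ModuleCat.epi_iff_surjective _).2 hf)

lemma mono_of_injective {M N : FGModuleCat.{u} R} (f : M ⟶ N)
    (hf : Function.Injective f.hom.hom) : Mono f :=
  (forget₂ (FGModuleCat R) (ModuleCat R)).mono_of_mono_map ((ModuleCat.mono_iff_injective _).2 hf)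

lemma exact_of_forall {A : ShortComplex (FGModuleCat.{u} R)}
    (h : ∀ x : A.X₂, A.g.hom.hom x = 0 → ∃ y : A.X₁, A.f.hom.hom y = x) : A.Exact :=
  (A.exact_map_iff_of_faithful (forget₂ (FGModuleCat R) (ModuleCat R))).1
    ((ShortComplex.moduleCat_exact_iff _).2 h)

/-- Testing against finitely generated modules suffices: a finite free cover of P already lies in
the category, and splitting it makes P a summand of a free module. -/
lemma projective_iff (P : FGModuleCat.{u} R) : Projective P ↔ Module.Projective R P := by
  refine ⟨fun h => ?_, fun h => ⟨fun {E X} f e he => ?_⟩⟩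
  · obtain ⟨n, f, hf⟩ := Module.Finite.exists_fin' R P
    let g : FGModuleCat.of R (Fin n → R) ⟶ P := ofHom f
    have : Epi g := epi_of_surjective g hf
    refine Module.Projective.of_split (Projective.factorThru (𝟙 P) g).hom.hom f ?_
    exact congrArg (fun k : P ⟶ P => k.hom.hom) (Projective.factorThru_comp (𝟙 P) g)
  · obtain ⟨g, hg⟩ := Module.projective_lifting_property e.hom.hom f.hom.hom (surjective_of_epi e)
    exact ⟨ofHom g, by ext x; exact LinearMap.congr_fun hg x⟩

end FGModuleCat

/-! ### The functor from the stable category to the singularity category -/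

section

variable (R : Type u) [CommRing R] [IsNoetherianRing R] [HasDerivedCategory.{w} (FGModuleCat.{u} R)]

lemma isPerfect_eq : isPerfect R = DerivedCategory.Bounded.perfect (FGModuleCat.{u} R) := by
  ext X
  simp only [isPerfect, DerivedCategory.Bounded.perfect, ObjectProperty.prop_inverseImage_iff,
    DerivedCategory.perfect, DerivedCategory.projectiveAmplitude, FGModuleCat.projective_iff]
  constructor
  · rintro ⟨K, ⟨a, ha⟩, ⟨b, hb⟩, hK, e⟩
    exact ⟨a, b, K, ha, hb, hK, e⟩
  · rintro ⟨a, b, K, ha, hb, hK, e⟩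
    exact ⟨K, ⟨a, ha⟩, ⟨b, hb⟩, hK, e⟩

variable {R}

lemma isLeftOrthogonalToProjectives_of_isGorensteinProjective {M : FGModuleCat.{u} R}
    (hM : isGorensteinProjective R M) :
    DerivedCategory.Bounded.IsLeftOrthogonalToProjectives M := by
  obtain ⟨K, ⟨hK, hK', hP⟩, i, ⟨e⟩⟩ := hM
  refine DerivedCategory.Bounded.isLeftOrthogonalToProjectives_of_iso e.symm
    (DerivedCategory.Bounded.isLeftOrthogonalToProjectives_syzygy hK'
      (fun i => (FGModuleCat.projective_iff _).2 (hK i)) (fun P _ i g hg => ?_) i)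
  exact hP P ((FGModuleCat.projective_iff P).1 inferInstance) i g hg

lemma SingularityCategory.stalk_map_eq {M N : FGModuleCat.{u} R} {f g : M ⟶ N}
    {P : FGModuleCat.{u} R} (hP : Module.Projective R P) (a : M ⟶ P) (b : P ⟶ N)
    (h : f - g = a ≫ b) :
    (SingularityCategory.stalk R).map f = (SingularityCategory.stalk R).map g := by
  change (isPerfect R).trW.Q.map ((DerivedCategory.Bounded.single _).map f) =
    (isPerfect R).trW.Q.map ((DerivedCategory.Bounded.single _).map g)
  have := (FGModuleCat.projective_iff P).2 hP
  rw [isPerfect_eq]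
  exact DerivedCategory.Bounded.Q_map_single_map_eq a b h

/-- Only the source has to be Gorenstein projective, because the vanishing of Ext is applied to maps
out of M. -/
lemma SingularityCategory.stalk_map_surjective {M N : FGModuleCat.{u} R}
    (hM : isGorensteinProjective R M) :
    Function.Surjective ((SingularityCategory.stalk R).map : (M ⟶ N) → _) := by
  change Function.Surjective fun f : M ⟶ N =>
    (isPerfect R).trW.Q.map ((DerivedCategory.Bounded.single _).map f)
  rw [isPerfect_eq]
  exact DerivedCategory.Bounded.exists_Q_map_single_map_eq
    (isLeftOrthogonalToProjectives_of_isGorensteinProjective hM)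

lemma SingularityCategory.exists_factor_of_stalk_map_eq {M N : FGModuleCat.{u} R}
    (hM : isGorensteinProjective R M) {f g : M ⟶ N}
    (h : (SingularityCategory.stalk R).map f = (SingularityCategory.stalk R).map g) :
    ∃ P : FGModuleCat.{u} R, Module.Projective R P ∧ ∃ (a : M ⟶ P) (b : P ⟶ N),
      f - g = a ≫ b := by
  change (isPerfect R).trW.Q.map ((DerivedCategory.Bounded.single _).map f) =
    (isPerfect R).trW.Q.map ((DerivedCategory.Bounded.single _).map g) at h
  rw [isPerfect_eq] at h
  obtain ⟨P, hP, a, b, hab⟩ := DerivedCategory.Bounded.exists_factor_of_Q_map_single_map_eq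
    (isLeftOrthogonalToProjectives_of_isGorensteinProjective hM) h
  exact ⟨P, (FGModuleCat.projective_iff P).1 hP, a, b, hab⟩

variable (R) in
/-- The functor from the stable category of Gorenstein projective modules to the singularity
category which sends a module to its stalk complex. -/
noncomputable def StableGp.toSingularityCategory : StableGp R ⥤ SingularityCategory R :=
  CategoryTheory.Quotient.lift (stablyEqual R) ((isGorensteinProjective R).ι ⋙ SingularityCategory.stalk R)
    fun _ _ _ _ ⟨_, hP, a, b, h⟩ => SingularityCategory.stalk_map_eq hP a b h

lemma StableGp.quotient_comp_toSingularityCategory :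
    StableGp.quotient R ⋙ StableGp.toSingularityCategory R =
      (isGorensteinProjective R).ι ⋙ SingularityCategory.stalk R :=
  CategoryTheory.Quotient.lift_spec _ _ _

instance : (StableGp.toSingularityCategory R).Full where
  map_surjective {X Y} φ := by
    obtain ⟨f, hf⟩ := SingularityCategory.stalk_map_surjective (N := Y.as.obj) X.as.property φ
    exact ⟨(StableGp.quotient R).map (ObjectProperty.homMk f), hf⟩

instance : (StableGp.toSingularityCategory R).Faithful where
  map_injective {X Y} f g h := by
    obtain ⟨f, rfl⟩ := (StableGp.quotient R).map_surjective f
    obtain ⟨g, rfl⟩ := (StableGp.quotient R).map_surjective g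
    exact CategoryTheory.Quotient.sound _ (SingularityCategory.exists_factor_of_stalk_map_eq X.as.property h)

end

/-! ### Matrix factorizations and reduction modulo ω -/

namespace Module

open TensorProduct

variable {S : Type u} [CommRing S] {ω : S}

lemma smul_right_injective_of_projective (hω : ω ∈ nonZeroDivisors S) (M : Type*) [AddCommGroup M]
    [Module S M] [Module.Projective S M] : Function.Injective fun x : M => ω • x :=
  Module.IsTorsionFree.isSMulRegular (isRegular_iff_mem_nonZeroDivisors.2 hω)

lemma one_tmul_eq_zero_iff {M : Type*} [AddCommGroup M] [Module S M] (x : M) :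
    (1 : S ⧸ Ideal.span {ω}) ⊗ₜ[S] x = 0 ↔ ∃ y : M, ω • y = x := by
  rw [← (quotTensorEquivQuotSMul M (Ideal.span {ω})).map_eq_zero_iff,
    quotTensorEquivQuotSMul_mk_one_tmul, Submodule.Quotient.mk_eq_zero,
    Submodule.ideal_span_singleton_smul, Submodule.mem_smul_pointwise_iff_exists]
  simp

lemma exists_one_tmul_eq {M : Type*} [AddCommGroup M] [Module S M]
    (x : (S ⧸ Ideal.span {ω}) ⊗[S] M) : ∃ y : M, (1 : S ⧸ Ideal.span {ω}) ⊗ₜ[S] y = x :=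
  TensorProduct.mk_surjective S M (S ⧸ Ideal.span {ω}) Ideal.Quotient.mk_surjective x

/-- Reduction modulo `ω` of a finite free module. -/
def reduction (ω : S) (n : ℕ) : (Fin n → S) →ₗ[S] (Fin n → S ⧸ Ideal.span {ω}) :=
  (Algebra.linearMap S (S ⧸ Ideal.span {ω})).compLeft (Fin n)

lemma reduction_surjective (n : ℕ) : Function.Surjective (reduction ω n) := fun x => by
  choose y hy using fun i => Ideal.Quotient.mk_surjective (x i)
  exact ⟨y, funext hy⟩

lemma reduction_eq_zero_iff {n : ℕ} (x : Fin n → S) :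
    reduction ω n x = 0 ↔ ∃ y : Fin n → S, ω • y = x := by
  constructor
  · intro h
    have (i : Fin n) : ∃ y, ω * y = x i := by
      obtain ⟨y, hy⟩ := Ideal.mem_span_singleton.1 (Ideal.Quotient.eq_zero_iff_mem.1 (congrFun h i))
      exact ⟨y, hy.symm⟩
    choose y hy using this
    exact ⟨y, funext hy⟩
  · rintro ⟨y, rfl⟩
    ext i
    exact Ideal.Quotient.eq_zero_iff_mem.2
      (Ideal.mul_mem_right _ _ (Ideal.mem_span_singleton_self ω))

/-- Pointwise division by ω is unique because ω is a non-zerodivisor, and is therefore linear. -/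
lemma exists_factor_smul (hω : ω ∈ nonZeroDivisors S) {M : Type*} [AddCommGroup M] [Module S M]
    {n : ℕ} (u : M →ₗ[S] (Fin n → S)) (hu : ∀ x, reduction ω n (u x) = 0) :
    ∃ v : M →ₗ[S] (Fin n → S), ∀ x, ω • v x = u x :=
  ⟨LinearMap.codRestrictOfInjective u (LinearMap.lsmul S _ ω)
    (smul_right_injective_of_projective hω _) fun x => (reduction_eq_zero_iff _).1 (hu x),
    fun x => LinearMap.codRestrictOfInjective_comp_apply u (LinearMap.lsmul S _ ω) _ _ x⟩

section MatrixFactorization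

variable {P Q : Type u} [AddCommGroup P] [Module S P] [AddCommGroup Q] [Module S Q] {φ : P →ₗ[S] Q} {ψ : Q →ₗ[S] P}

lemma injective_of_comp_eq_smul [Module.Projective S P] (hω : ω ∈ nonZeroDivisors S) (h : ∀ x, ψ (φ x) = ω • x) :
    Function.Injective φ := fun x y hxy =>
  smul_right_injective_of_projective hω P (by simp only [← h, hxy])

/-- If `φψ = ω` and `ψφ = ω`, then the reductions of `φ` and `ψ` modulo `ω` form an exact
sequence. -/
lemma exists_baseChange_eq [Module.Projective S P] (hω : ω ∈ nonZeroDivisors S) (hφψ : ∀ x, φ (ψ x) = ω • x)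
    (hψφ : ∀ x, ψ (φ x) = ω • x)
    (x : (S ⧸ Ideal.span {ω}) ⊗[S] P) (hx : φ.baseChange (S ⧸ Ideal.span {ω}) x = 0) :
    ∃ y, ψ.baseChange (S ⧸ Ideal.span {ω}) y = x := by
  obtain ⟨p, rfl⟩ := exists_one_tmul_eq x
  rw [LinearMap.baseChange_tmul, one_tmul_eq_zero_iff] at hx
  obtain ⟨q, hq⟩ := hx
  refine ⟨1 ⊗ₜ q, ?_⟩
  rw [LinearMap.baseChange_tmul]
  -- From φp = ωq = φ(ψq) and the injectivity of φ it follows that p = ψq.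
  exact congrArg _ (injective_of_comp_eq_smul hω hψφ (by rw [hφψ, hq]))

lemma baseChange_baseChange_eq_zero (hφψ : ∀ x, φ (ψ x) = ω • x)
    (x : (S ⧸ Ideal.span {ω}) ⊗[S] Q) :
    φ.baseChange (S ⧸ Ideal.span {ω}) (ψ.baseChange (S ⧸ Ideal.span {ω}) x) = 0 := by
  obtain ⟨q, rfl⟩ := exists_one_tmul_eq x
  rw [LinearMap.baseChange_tmul, LinearMap.baseChange_tmul, hφψ, one_tmul_eq_zero_iff]
  exact ⟨q, rfl⟩

/-- Lift g to u : Q → S^n. Then uφ vanishes modulo ω, say uφ = ωv, and ωvψ = uφψ = ωu gives vψ = u.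
The reduction of v is the required map. -/
lemma exists_comp_baseChange_eq_of_free [Module.Projective S Q] (hω : ω ∈ nonZeroDivisors S)
    (hφψ : ∀ x, φ (ψ x) = ω • x) {n : ℕ}
    (g : (S ⧸ Ideal.span {ω}) ⊗[S] Q →ₗ[S ⧸ Ideal.span {ω}] (Fin n → S ⧸ Ideal.span {ω}))
    (hg : ∀ x, g (φ.baseChange (S ⧸ Ideal.span {ω}) x) = 0) :
    ∃ h : (S ⧸ Ideal.span {ω}) ⊗[S] P →ₗ[S ⧸ Ideal.span {ω}] (Fin n → S ⧸ Ideal.span {ω}),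
      ∀ x, h (ψ.baseChange (S ⧸ Ideal.span {ω}) x) = g x := by
  obtain ⟨u, hu⟩ := Module.projective_lifting_property (reduction ω n)
    (g.restrictScalars S ∘ₗ TensorProduct.mk S (S ⧸ Ideal.span {ω}) Q 1) (reduction_surjective n)
  replace hu (q : Q) : reduction ω n (u q) = g (1 ⊗ₜ q) := LinearMap.congr_fun hu q
  obtain ⟨v, hv⟩ := exists_factor_smul hω (u ∘ₗ φ) fun p => by
    rw [LinearMap.comp_apply, hu]
    exact hg (1 ⊗ₜ p)
  refine ⟨(reduction ω n ∘ₗ v).liftBaseChange (S ⧸ Ideal.span {ω}), fun x => ?_⟩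
  obtain ⟨q, rfl⟩ := exists_one_tmul_eq x
  rw [LinearMap.baseChange_tmul, LinearMap.liftBaseChange_one_tmul, LinearMap.comp_apply, ← hu]
  congr 1
  apply smul_right_injective_of_projective hω (Fin n → S)
  simp only [hv, LinearMap.comp_apply, hφψ, map_smul]

/-- If `φψ = ω` and `ψφ = ω`, then the reductions of `φ` and `ψ` modulo `ω` form an exact
sequence which remains exact under maps to finitely generated projective modules. -/
lemma exists_comp_baseChange_eq [Module.Projective S Q] (hω : ω ∈ nonZeroDivisors S)
    (hφψ : ∀ x, φ (ψ x) = ω • x)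
    {L : Type*} [AddCommGroup L] [Module (S ⧸ Ideal.span {ω}) L]
    [Module.Finite (S ⧸ Ideal.span {ω}) L] [Module.Projective (S ⧸ Ideal.span {ω}) L]
    (g : (S ⧸ Ideal.span {ω}) ⊗[S] Q →ₗ[S ⧸ Ideal.span {ω}] L)
    (hg : ∀ x, g (φ.baseChange (S ⧸ Ideal.span {ω}) x) = 0) :
    ∃ h : (S ⧸ Ideal.span {ω}) ⊗[S] P →ₗ[S ⧸ Ideal.span {ω}] L,
      ∀ x, h (ψ.baseChange (S ⧸ Ideal.span {ω}) x) = g x := by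
  obtain ⟨n, r, i, -, -, hri⟩ := Module.Finite.exists_comp_eq_id_of_projective
    (S ⧸ Ideal.span {ω}) L
  obtain ⟨h, hh⟩ := exists_comp_baseChange_eq_of_free hω hφψ (i ∘ₗ g) fun x => by simp [hg]
  refine ⟨r ∘ₗ h, fun x => ?_⟩
  rw [LinearMap.comp_apply, hh]
  exact LinearMap.congr_fun hri (g x)

end MatrixFactorization

end Module

/-! ### Two-periodic complexes and Gorenstein projectivity -/

namespace CochainComplex

variable {C : Type*} [Category* C] [HasZeroMorphisms C]

/-- The complex `⋯ ⟶ A --a--> A --b--> A --a--> A ⟶ ⋯`, where the differential `a` starts in the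
even degrees. -/
def alternating {A : C} (a b : A ⟶ A) (hab : a ≫ b = 0) (hba : b ≫ a = 0) :
    CochainComplex C ℤ where
  X _ := A
  d i j := if i + 1 = j then if Even i then a else b else 0
  shape i j hij := if_neg hij
  d_comp_d' i j k hij hjk := by
    obtain rfl : i + 1 = j := hij
    obtain rfl : i + 1 + 1 = k := hjk
    simp only [if_true, Int.even_add_one]
    split_ifs <;> simp_all

variable {A : C} {a b : A ⟶ A} (hab : a ≫ b = 0) (hba : b ≫ a = 0)

lemma alternating_d {i j : ℤ} (hij : i + 1 = j) :
    (alternating a b hab hba).d i j = if Even i then a else b := if_pos hij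

end CochainComplex

section

variable {R : Type u} [CommRing R] [IsNoetherianRing R]

open CochainComplex

lemma isTotallyAcyclic_alternating {A : FGModuleCat.{u} R} (hA : Module.Projective R A)
    {a b : A ⟶ A} (hab : a ≫ b = 0) (hba : b ≫ a = 0)
    (ha : ∀ x : A, a.hom.hom x = 0 → ∃ y : A, b.hom.hom y = x)
    (hb : ∀ x : A, b.hom.hom x = 0 → ∃ y : A, a.hom.hom y = x)
    (ha' : ∀ (P : FGModuleCat.{u} R), Module.Projective R P → ∀ g : A ⟶ P, a ≫ g = 0 →
      ∃ h : A ⟶ P, b ≫ h = g)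
    (hb' : ∀ (P : FGModuleCat.{u} R), Module.Projective R P → ∀ g : A ⟶ P, b ≫ g = 0 →
      ∃ h : A ⟶ P, a ≫ h = g) :
    IsTotallyAcyclic (alternating a b hab hba) := by
  have parity (i : ℤ) : Even (i - 1) ↔ ¬ Even i := by
    have := Int.even_add_one (n := i - 1)
    rw [sub_add_cancel] at this
    tauto
  refine ⟨fun i => hA, fun i => ?_, fun P hP i g hg => ?_⟩
  · rw [HomologicalComplex.exactAt_iff' _ (i - 1) i (i + 1) (by simp) (by simp)]
    refine FGModuleCat.exact_of_forall fun x hx => ?_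
    change ((alternating a b hab hba).d i (i + 1)).hom.hom x = 0 at hx
    change ∃ y : A, ((alternating a b hab hba).d (i - 1) i).hom.hom y = x
    rw [alternating_d hab hba rfl] at hx
    rw [alternating_d hab hba (sub_add_cancel i 1)]
    by_cases hi : Even i
    · rw [if_pos hi] at hx
      rw [if_neg (by rwa [parity, not_not])]
      exact ha x hx
    · rw [if_neg hi] at hx
      rw [if_pos (by rwa [parity])]
      exact hb x hx
  · rw [alternating_d hab hba (sub_add_cancel i 1)] at hg
    rw [alternating_d hab hba rfl]
    by_cases hi : Even i
    · rw [if_neg (by rwa [parity, not_not])] at hg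
      rw [if_pos hi]
      exact hb' P hP g hg
    · rw [if_pos (by rwa [parity])] at hg
      rw [if_neg hi]
      exact ha' P hP g hg

lemma isGorensteinProjective_of_alternating {A M : FGModuleCat.{u} R} {a b : A ⟶ A}
    {hab : a ≫ b = 0} {hba : b ≫ a = 0} (hK : IsTotallyAcyclic (alternating a b hab hba))
    (j : M ⟶ A) (hj : Function.Injective j.hom.hom) (hja : j ≫ a = 0)
    (H : ∀ x : A, a.hom.hom x = 0 → ∃ m : M, j.hom.hom m = x) :
    isGorensteinProjective R M := by
  refine ⟨_, hK, 0, ⟨?_⟩⟩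
  have hd : (alternating a b hab hba).d 0 (0 + 1) = a := by
    rw [alternating_d hab hba rfl, if_pos Even.zero]
  have := FGModuleCat.mono_of_injective j hj
  have h : (ShortComplex.mk j a hja).Exact := FGModuleCat.exact_of_forall H
  exact h.fIsKernel.conePointUniqueUpToIso (limit.isLimit (parallelPair a 0)) ≪≫
    kernelIsoOfEq hd.symm

end

section

open TensorProduct

variable {S : Type u} [CommRing S] [IsNoetherianRing S] {ω : S}

/-- The cokernel of one of the two maps of a matrix factorization of `ω` is Gorenstein projective
over `S/(ω)`. -/
lemma isGorensteinProjective_of_matrixFactorization (hω : ω ∈ nonZeroDivisors S)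
    {P : Type u} [AddCommGroup P] [Module S P] [Module.Finite S P] [Module.Projective S P]
    {φ ψ : P →ₗ[S] P} (hφψ : ∀ x, φ (ψ x) = ω • x) (hψφ : ∀ x, ψ (φ x) = ω • x)
    {M : FGModuleCat.{u} (S ⧸ Ideal.span {ω})}
    (j : M →ₗ[S ⧸ Ideal.span {ω}] (S ⧸ Ideal.span {ω}) ⊗[S] P) (hj : Function.Injective j)
    (hjφ : ∀ x, φ.baseChange (S ⧸ Ideal.span {ω}) (j x) = 0)
    (H : ∀ y, φ.baseChange (S ⧸ Ideal.span {ω}) (ψ.baseChange (S ⧸ Ideal.span {ω}) y) = 0 →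
      ∃ m, j m = ψ.baseChange (S ⧸ Ideal.span {ω}) y) :
    isGorensteinProjective (S ⧸ Ideal.span {ω}) M := by
  let A := FGModuleCat.of (S ⧸ Ideal.span {ω}) ((S ⧸ Ideal.span {ω}) ⊗[S] P)
  let a : A ⟶ A := FGModuleCat.ofHom (φ.baseChange (S ⧸ Ideal.span {ω}))
  let b : A ⟶ A := FGModuleCat.ofHom (ψ.baseChange (S ⧸ Ideal.span {ω}))
  have hab : a ≫ b = 0 := FGModuleCat.hom_ext <| LinearMap.ext fun x =>
    Module.baseChange_baseChange_eq_zero hψφ x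
  have hba : b ≫ a = 0 := FGModuleCat.hom_ext <| LinearMap.ext fun x =>
    Module.baseChange_baseChange_eq_zero hφψ x
  have hA : Module.Projective (S ⧸ Ideal.span {ω}) A :=
    inferInstanceAs (Module.Projective _ ((S ⧸ Ideal.span {ω}) ⊗[S] P))
  have lift {φ ψ : P →ₗ[S] P} (hφψ : ∀ x, φ (ψ x) = ω • x)
      (L : FGModuleCat.{u} (S ⧸ Ideal.span {ω})) (hL : Module.Projective (S ⧸ Ideal.span {ω}) L) (g : A ⟶ L)
      (hg : FGModuleCat.ofHom (φ.baseChange (S ⧸ Ideal.span {ω})) ≫ g = 0) :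
      ∃ h : A ⟶ L, FGModuleCat.ofHom (ψ.baseChange (S ⧸ Ideal.span {ω})) ≫ h = g := by
    obtain ⟨h, hh⟩ := Module.exists_comp_baseChange_eq hω hφψ g.hom.hom
      fun x => FGModuleCat.hom_apply_eq_zero hg x
    exact ⟨FGModuleCat.ofHom h, FGModuleCat.hom_ext <| LinearMap.ext hh⟩
  have hK : IsTotallyAcyclic (CochainComplex.alternating a b hab hba) :=
    isTotallyAcyclic_alternating hA hab hba
      (fun x hx => Module.exists_baseChange_eq hω hφψ hψφ x hx)
      (fun x hx => Module.exists_baseChange_eq hω hψφ hφψ x hx) (lift hφψ) (lift hψφ)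
  refine isGorensteinProjective_of_alternating hK (FGModuleCat.ofHom j) hj
    (FGModuleCat.hom_ext <| LinearMap.ext hjφ) fun x hx => ?_
  -- By exactness the kernel of the reduced φ is the image of the reduced ψ, and `H` places that
  -- image in the range of j.
  obtain ⟨y, rfl⟩ := Module.exists_baseChange_eq hω hφψ hψφ x hx
  exact H y hx

end

/-! ### Objects of `Mon(ω, P)`, their cokernels and homotopies -/

namespace MonProj

open TensorProduct

variable {S : Type u} [CommRing S] {ω : S}

instance (X : MonProj ω) : Module.Projective S X.obj.left := X.property.1

instance (X : MonProj ω) : Module.Projective S X.obj.right := X.property.2.1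

/-- The underlying linear map of an object of `Mon(ω, P)`. -/
abbrev toLinearMap (X : MonProj ω) : X.obj.left →ₗ[S] X.obj.right := X.obj.hom.hom.hom

lemma toLinearMap_injective (X : MonProj ω) : Function.Injective X.toLinearMap := X.property.2.2.1

/-- The projection onto the cokernel. -/
def mk (X : MonProj ω) : X.obj.right →ₗ[S] X.Coker := Submodule.mkQ _

lemma mk_surjective (X : MonProj ω) : Function.Surjective X.mk := Submodule.mkQ_surjective _

lemma mk_eq_zero_iff (X : MonProj ω) (q : X.obj.right) :
    X.mk q = 0 ↔ q ∈ LinearMap.range X.toLinearMap := Submodule.Quotient.mk_eq_zero _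

lemma mk_toLinearMap (X : MonProj ω) (p : X.obj.left) : X.mk (X.toLinearMap p) = 0 :=
  (X.mk_eq_zero_iff _).2 ⟨p, rfl⟩

lemma cokerMap_mk {X Y : MonProj ω} (φ : X ⟶ Y) (q : X.obj.right) :
    cokerMap φ (X.mk q) = Y.mk (φ.hom.right.hom.hom q) := rfl

lemma hom_right_toLinearMap {X Y : MonProj ω} (φ : X ⟶ Y) (p : X.obj.left) :
    φ.hom.right.hom.hom (X.toLinearMap p) = Y.toLinearMap (φ.hom.left.hom.hom p) :=
  (congrArg (fun k : X.obj.left ⟶ Y.obj.right => k.hom.hom p) φ.hom.w).symm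

/-- Linear maps out of the cokernel. -/
lemma exists_desc (X : MonProj ω) {N : Type*} [AddCommGroup N] [Module S N]
    [Module (S ⧸ Ideal.span {ω}) N] [IsScalarTower S (S ⧸ Ideal.span {ω}) N]
    (u : X.obj.right →ₗ[S] N) (hu : ∀ p, u (X.toLinearMap p) = 0) :
    ∃ v : X.Coker →ₗ[S ⧸ Ideal.span {ω}] N, ∀ q, v (X.mk q) = u q := by
  let v : X.Coker →ₗ[S] N := Submodule.liftQ (LinearMap.range X.toLinearMap) u (by
    rintro _ ⟨p, rfl⟩
    exact hu p)
  exact ⟨v.extendScalarsOfSurjective Ideal.Quotient.mk_surjective, fun q => rfl⟩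

/-- The map `σ` such that `(f, σ)` is a matrix factorization of `ω`. -/
lemma exists_matrixFactorization (X : MonProj ω) :
    ∃ σ : X.obj.right →ₗ[S] X.obj.left, (∀ q, X.toLinearMap (σ q) = ω • q) ∧
      ∀ p, σ (X.toLinearMap p) = ω • p := by
  have h (q : X.obj.right) : ω • q ∈ LinearMap.range X.toLinearMap := by
    rw [← mk_eq_zero_iff, map_smul]
    have h := X.property.2.2.2
    exact @h (X.mk q)
  let σ := LinearMap.codRestrictOfInjective (LinearMap.lsmul S _ ω) X.toLinearMap
    X.toLinearMap_injective h
  have hσ (q : X.obj.right) : X.toLinearMap (σ q) = ω • q :=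
    LinearMap.codRestrictOfInjective_comp_apply _ _ _ _ q
  exact ⟨σ, hσ, fun p => X.toLinearMap_injective (by rw [hσ, map_smul])⟩

/-- Projectives over a local ring are free, and the injections f and σ in opposite directions force
equal ranks. -/
lemma nonempty_linearEquiv [IsLocalRing S] (hω : ω ∈ nonZeroDivisors S) (X : MonProj ω) :
    Nonempty (X.obj.right ≃ₗ[S] X.obj.left) := by
  obtain ⟨σ, hσ, -⟩ := X.exists_matrixFactorization
  have : Module.Free S X.obj.left := Module.free_of_flat_of_isLocalRing
  have : Module.Free S X.obj.right := Module.free_of_flat_of_isLocalRing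
  exact ⟨.ofFinrankEq _ _ (le_antisymm
    (LinearMap.finrank_le_finrank_of_injective (Module.injective_of_comp_eq_smul hω hσ))
    (LinearMap.finrank_le_finrank_of_injective X.toLinearMap_injective))⟩

/-- The alternating complex has the same module in every degree, so Q is first identified with P
through e. The embedding of Coker f into R ⊗ P sends the class of q to 1 ⊗ σq; it is well defined
because σf = ω. -/
lemma isGorensteinProjective_coker [IsLocalRing S] [IsNoetherianRing S]
    (hω : ω ∈ nonZeroDivisors S) (X : MonProj ω) :
    isGorensteinProjective (S ⧸ Ideal.span {ω}) ((MonProj.coker ω).obj X) := by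
  obtain ⟨σ, hσ, hσ'⟩ := X.exists_matrixFactorization
  obtain ⟨e⟩ := X.nonempty_linearEquiv hω
  obtain ⟨j, hj⟩ := X.exists_desc (TensorProduct.mk S (S ⧸ Ideal.span {ω}) X.obj.left 1 ∘ₗ σ)
    fun p => by
      rw [LinearMap.comp_apply, hσ']
      exact (Module.one_tmul_eq_zero_iff _).2 ⟨p, rfl⟩
  replace hj (q : X.obj.right) : j (X.mk q) = 1 ⊗ₜ σ q := hj q
  have hφψ (p : X.obj.left) : (e.toLinearMap ∘ₗ X.toLinearMap) ((σ ∘ₗ e.symm.toLinearMap) p) =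
      ω • p := by simp [hσ]
  refine isGorensteinProjective_of_matrixFactorization (φ := e.toLinearMap ∘ₗ X.toLinearMap)
    (ψ := σ ∘ₗ e.symm.toLinearMap) hω hφψ (fun p => by simp [hσ']) (M := (coker ω).obj X) j ?_ ?_ ?_
  · refine (injective_iff_map_eq_zero j).2 fun x hx => ?_
    obtain ⟨q, rfl⟩ := X.mk_surjective x
    rw [hj, Module.one_tmul_eq_zero_iff] at hx
    obtain ⟨p, hp⟩ := hx
    refine (X.mk_eq_zero_iff q).2 ⟨p, ?_⟩
    -- If σq = ωp = σ(fp), then q = fp because σ is injective.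
    apply Module.injective_of_comp_eq_smul hω hσ
    rw [hσ', hp]
  · intro x
    obtain ⟨q, rfl⟩ := X.mk_surjective x
    refine (congrArg _ (hj q)).trans ?_
    rw [LinearMap.baseChange_tmul, LinearMap.comp_apply, hσ, Module.one_tmul_eq_zero_iff]
    exact ⟨e q, by simp⟩
  · intro y _
    obtain ⟨p, rfl⟩ := Module.exists_one_tmul_eq y
    exact ⟨X.mk (e.symm p), hj _⟩

/-- Homotopic morphisms induce stably equal maps of cokernels. -/
lemma exists_factor_of_monHomotopic (hω : ω ∈ nonZeroDivisors S) {X Y : MonProj ω} {φ ψ : X ⟶ Y}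
    (h : monHomotopic ω φ ψ) :
    ∃ L : FGModuleCat.{u} (S ⧸ Ideal.span {ω}), Module.Projective (S ⧸ Ideal.span {ω}) L ∧
      ∃ (a : (coker ω).obj X ⟶ L) (b : L ⟶ (coker ω).obj Y),
        (coker ω).map φ - (coker ω).map ψ = a ≫ b := by
  obtain ⟨s₁, s₀, hs⟩ := h
  replace hs (p : X.obj.left) : Y.toLinearMap (φ.hom.left.hom.hom p - ψ.hom.left.hom.hom p) -
      Y.toLinearMap (s₀.hom.hom (X.toLinearMap p)) = ω • s₁.hom.hom p :=
    congrArg (fun k : X.obj.left ⟶ Y.obj.right => k.hom.hom p) hs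
  obtain ⟨σ, hσ, hσ'⟩ := X.exists_matrixFactorization
  obtain ⟨a, ha⟩ := X.exists_desc (TensorProduct.mk S (S ⧸ Ideal.span {ω}) X.obj.left 1 ∘ₗ σ)
    fun p => by
      rw [LinearMap.comp_apply, hσ']
      exact (Module.one_tmul_eq_zero_iff _).2 ⟨p, rfl⟩
  replace ha (q : X.obj.right) : a (X.mk q) = 1 ⊗ₜ σ q := ha q
  let b : (S ⧸ Ideal.span {ω}) ⊗[S] X.obj.left →ₗ[S ⧸ Ideal.span {ω}] Y.Coker :=
    (Y.mk ∘ₗ s₁.hom.hom).liftBaseChange (S ⧸ Ideal.span {ω})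
  refine ⟨FGModuleCat.of _ ((S ⧸ Ideal.span {ω}) ⊗[S] X.obj.left),
    inferInstanceAs (Module.Projective _ ((S ⧸ Ideal.span {ω}) ⊗[S] X.obj.left)),
    FGModuleCat.ofHom a, FGModuleCat.ofHom b, FGModuleCat.hom_ext <| LinearMap.ext fun x => ?_⟩
  obtain ⟨q, rfl⟩ := X.mk_surjective x
  change cokerMap φ (X.mk q) - cokerMap ψ (X.mk q) = b (a (X.mk q))
  -- After multiplication by ω, replace ωq by fσq, use commutativity of the squares, and apply the
  -- homotopy at σq. The first summand dies in Coker f'; the second factors through R ⊗ P.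
  have key : φ.hom.right.hom.hom q - ψ.hom.right.hom.hom q =
      Y.toLinearMap (s₀.hom.hom q) + s₁.hom.hom (σ q) := by
    apply Module.smul_right_injective_of_projective hω
    simp only [smul_add, smul_sub, ← hs, ← map_smul, ← hσ, hom_right_toLinearMap, map_sub]
    abel
  rw [ha, LinearMap.liftBaseChange_one_tmul, cokerMap_mk, cokerMap_mk, ← map_sub, key, map_add,
    mk_toLinearMap, zero_add]
  rfl

/-- Morphisms which induce stably equal maps of cokernels are homotopic. -/
lemma monHomotopic_of_factor (hω : ω ∈ nonZeroDivisors S) {X Y : MonProj ω} {φ ψ : X ⟶ Y}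
    {L : FGModuleCat.{u} (S ⧸ Ideal.span {ω})} (hL : Module.Projective (S ⧸ Ideal.span {ω}) L)
    (a : (coker ω).obj X ⟶ L) (b : L ⟶ (coker ω).obj Y)
    (h : (coker ω).map φ - (coker ω).map ψ = a ≫ b) : monHomotopic ω φ ψ := by
  -- As a retract of R^n, L may be replaced by R^n, which lifts to S^n; then a and b lift to u : Q →
  -- S^n and v : S^n → Q'.
  obtain ⟨n, r, i, -, -, hri⟩ := Module.Finite.exists_comp_eq_id_of_projective
    (S ⧸ Ideal.span {ω}) L
  let a' : X.Coker →ₗ[S ⧸ Ideal.span {ω}] (Fin n → S ⧸ Ideal.span {ω}) := i ∘ₗ a.hom.hom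
  let b' : (Fin n → S ⧸ Ideal.span {ω}) →ₗ[S ⧸ Ideal.span {ω}] Y.Coker := b.hom.hom ∘ₗ r
  have hab (q : X.obj.right) : Y.mk (φ.hom.right.hom.hom q - ψ.hom.right.hom.hom q) =
      b' (a' (X.mk q)) := by
    have h₁ : Y.mk (φ.hom.right.hom.hom q - ψ.hom.right.hom.hom q) =
        b.hom.hom (a.hom.hom (X.mk q)) := by
      rw [map_sub]
      exact congrArg (fun k : (coker ω).obj X ⟶ (coker ω).obj Y => k.hom.hom (X.mk q)) h
    rw [h₁]
    exact congrArg b.hom.hom (LinearMap.congr_fun hri (a.hom.hom (X.mk q))).symm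
  obtain ⟨u, hu⟩ := Module.projective_lifting_property (Module.reduction ω n)
    (a'.restrictScalars S ∘ₗ X.mk) (Module.reduction_surjective n)
  replace hu (q : X.obj.right) : Module.reduction ω n (u q) = a' (X.mk q) :=
    LinearMap.congr_fun hu q
  obtain ⟨v, hv⟩ := Module.projective_lifting_property Y.mk
    (b'.restrictScalars S ∘ₗ Module.reduction ω n) Y.mk_surjective
  replace hv (x : Fin n → S) : Y.mk (v x) = b' (Module.reduction ω n x) := LinearMap.congr_fun hv x
  -- Write uf = ωt. The map φ₀ - ψ₀ - vu vanishes in Coker f', so it equals f's₀. Composing with f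
  -- leaves vuf = ω(vt), hence s₁ = vt.
  obtain ⟨t, ht⟩ := Module.exists_factor_smul hω (u ∘ₗ X.toLinearMap) fun p => by
    rw [LinearMap.comp_apply, hu, mk_toLinearMap, map_zero]
  let s₀ := LinearMap.codRestrictOfInjective
    (φ.hom.right.hom.hom - ψ.hom.right.hom.hom - v ∘ₗ u) Y.toLinearMap Y.toLinearMap_injective
    fun q => by
      rw [← mk_eq_zero_iff]
      change Y.mk (φ.hom.right.hom.hom q - ψ.hom.right.hom.hom q - v (u q)) = 0
      rw [map_sub, hab, hv, hu, sub_self]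
  have hs₀ (q : X.obj.right) : Y.toLinearMap (s₀ q) =
      φ.hom.right.hom.hom q - ψ.hom.right.hom.hom q - v (u q) :=
    LinearMap.codRestrictOfInjective_comp_apply _ _ _ _ q
  refine ⟨FGModuleCat.ofHom (v ∘ₗ t), FGModuleCat.ofHom s₀,
    FGModuleCat.hom_ext <| LinearMap.ext fun p => ?_⟩
  change Y.toLinearMap (φ.hom.left.hom.hom p - ψ.hom.left.hom.hom p) -
      Y.toLinearMap (s₀ (X.toLinearMap p)) = ω • v (t p)
  rw [hs₀, map_sub, hom_right_toLinearMap, hom_right_toLinearMap, sub_sub_cancel, ← map_smul, ht]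
  rfl

/-- Projectivity of Q lifts the map to u : Q → Q'; then uf lands in the range of the injective f',
which determines the component P → P'. -/
lemma coker_map_surjective (X Y : MonProj ω) :
    Function.Surjective ((coker ω).map : (X ⟶ Y) → _) := by
  intro g
  let g' : X.Coker →ₗ[S ⧸ Ideal.span {ω}] Y.Coker := g.hom.hom
  obtain ⟨u, hu⟩ := Module.projective_lifting_property Y.mk (g'.restrictScalars S ∘ₗ X.mk)
    Y.mk_surjective
  replace hu (q : X.obj.right) : Y.mk (u q) = g' (X.mk q) := LinearMap.congr_fun hu q
  let v := LinearMap.codRestrictOfInjective (u ∘ₗ X.toLinearMap) Y.toLinearMap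
    Y.toLinearMap_injective fun p => by
      rw [← mk_eq_zero_iff, LinearMap.comp_apply, hu, mk_toLinearMap, map_zero]
  have hv (p : X.obj.left) : Y.toLinearMap (v p) = u (X.toLinearMap p) :=
    LinearMap.codRestrictOfInjective_comp_apply _ _ _ _ p
  refine ⟨ObjectProperty.homMk (Arrow.homMk (FGModuleCat.ofHom v) (FGModuleCat.ofHom u)
    (FGModuleCat.hom_ext <| LinearMap.ext hv)), FGModuleCat.hom_ext <| LinearMap.ext fun x => ?_⟩
  obtain ⟨q, rfl⟩ := X.mk_surjective x
  exact hu q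

end MonProj

/-! ### The functor from `HMon(ω, P)` to the stable category, and the theorem -/

section

variable {S : Type u} [CommRing S] [IsLocalRing S] [IsNoetherianRing S] {ω : S}

/-- The functor `HMon(ω, P) ⥤ Gp(R)` to the stable category which sends `f` to `Coker f`. -/
def HMonProj.toStableGp (hω : ω ∈ nonZeroDivisors S) :
    HMonProj ω ⥤ StableGp (S ⧸ Ideal.span {ω}) :=
  CategoryTheory.Quotient.lift (monHomotopic ω)
    ((isGorensteinProjective (S ⧸ Ideal.span {ω})).lift (MonProj.coker ω)
      (MonProj.isGorensteinProjective_coker hω) ⋙ StableGp.quotient (S ⧸ Ideal.span {ω}))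
    fun _ _ _ _ h => CategoryTheory.Quotient.sound _ (MonProj.exists_factor_of_monHomotopic hω h)

lemma HMonProj.full_toStableGp (hω : ω ∈ nonZeroDivisors S) :
    (HMonProj.toStableGp hω).Full where
  map_surjective {X Y} φ := by
    obtain ⟨g, rfl⟩ := (StableGp.quotient _).map_surjective φ
    obtain ⟨f, hf⟩ := MonProj.coker_map_surjective X.as Y.as g.hom
    refine ⟨(HMonProj.quotient ω).map f, ?_⟩
    exact congrArg (StableGp.quotient _).map (ObjectProperty.hom_ext _ hf)

lemma HMonProj.faithful_toStableGp (hω : ω ∈ nonZeroDivisors S) :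
    (HMonProj.toStableGp hω).Faithful where
  map_injective {X Y} f g h := by
    obtain ⟨f, rfl⟩ := (HMonProj.quotient ω).map_surjective f
    obtain ⟨g, rfl⟩ := (HMonProj.quotient ω).map_surjective g
    obtain ⟨L, hL, a, b, hab⟩ := (CategoryTheory.Quotient.functor_map_eq_iff _ _ _).1 h
    exact CategoryTheory.Quotient.sound _ (MonProj.monHomotopic_of_factor hω hL a b hab)

end

theorem mainTheorem3 {S : Type u} [CommRing S] [IsLocalRing S] [IsNoetherianRing S] (ω : S)
    (hω : ω ∈ IsLocalRing.maximalIdeal S) (hreg : ω ∈ nonZeroDivisors S)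
    [HasDerivedCategory.{w} (FGModuleCat.{u} (S ⧸ Ideal.span {ω}))] :
    ∃ (hG : ∀ X : MonProj ω,
          isGorensteinProjective (S ⧸ Ideal.span {ω}) ((MonProj.coker ω).obj X))
      (T : HMonProj ω ⥤ StableGp (S ⧸ Ideal.span {ω}))
      (T' : StableGp (S ⧸ Ideal.span {ω}) ⥤ SingularityCategory (S ⧸ Ideal.span {ω}))
      (F : HMonProj ω ⥤ SingularityCategory (S ⧸ Ideal.span {ω})),
      (T.Full ∧ T.Faithful ∧
        HMonProj.quotient ω ⋙ T =
          (isGorensteinProjective (S ⧸ Ideal.span {ω})).lift (MonProj.coker ω) hG ⋙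
            StableGp.quotient (S ⧸ Ideal.span {ω})) ∧
      (T'.Full ∧ T'.Faithful ∧
        StableGp.quotient (S ⧸ Ideal.span {ω}) ⋙ T' =
          (isGorensteinProjective (S ⧸ Ideal.span {ω})).ι ⋙
            SingularityCategory.stalk (S ⧸ Ideal.span {ω})) ∧
      F = T ⋙ T' ∧
      F.Full ∧ F.Faithful ∧
      HMonProj.quotient ω ⋙ F =
        MonProj.coker ω ⋙ SingularityCategory.stalk (S ⧸ Ideal.span {ω}) := by
  have hT := HMonProj.full_toStableGp hreg
  have hT' := HMonProj.faithful_toStableGp hreg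
  refine ⟨MonProj.isGorensteinProjective_coker hreg, HMonProj.toStableGp hreg,
    StableGp.toSingularityCategory _, HMonProj.toStableGp hreg ⋙ StableGp.toSingularityCategory _,
    ⟨hT, hT', CategoryTheory.Quotient.lift_spec _ _ _⟩,
    ⟨inferInstance, inferInstance, StableGp.quotient_comp_toSingularityCategory⟩, rfl,
    inferInstance, inferInstance, ?_⟩
  rw [← Functor.assoc, HMonProj.toStableGp, CategoryTheory.Quotient.lift_spec, Functor.assoc,
    StableGp.quotient_comp_toSingularityCategory]
  rfl
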